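/- A strictly increasing function $f:\mathbb{N}\to\mathbb{N}$ (where $0\in\mathbb{N}$) is *permissible* if $f(0)=1$ and, for all $n\ge 1$, $$\tfrac12\big(f(n)-f(n-1)\big)\le f(n+1)-f(n)\le 2\big(f(n)-f(n-1)\big).$$ For a group $\Gamma$ and $F\subseteq\Gamma$, a *local embedding* of $F$ into a group $Q$ is an injective map $\pi:F\to Q$ such that $\pi(gh)=\pi(g)\pi(h)$ whenever $g,h,gh\in F$. The group $\Gamma$ is *LEF* if every finite subset of $\Gamma$ has a local embedding into some finite group. If $\Gamma$ is generated by a finite set $S$ and $B_S(n)$ is the ball of radius $n$ around $1$ in the word metric defined by $S\cup S^{-1}$, the *LEF growth* $\mathcal{L}_\Gamma^S(n)$ is the least order of a finite group into which $B_S(n)$ has a local embedding ($\infty$ if there is none). For functions $u,v$ on $\mathbb{N}$, extended to $(0,\infty)$ so as to be constant on each interval $[n,n+1)$, write $u\preceq v$ if there is a constant $C>0$ with $u(x)\le v(Cx)$ for all $x>0$, and $u\approx v$ if $u\preceq v$ and $v\preceq u$. For an action of $\Gamma$ on a set $\Omega$, let $\mathrm{FSym}(\Omega)$ be the group of finitely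 supported permutations of $\Omega$; the *symmetric enrichment* is $\mathcal{S}(\Gamma,\Omega)=\mathrm{FSym}(\Omega)\rtimes\Gamma$, where $\Gamma$ acts by conjugation through $\Gamma\to\mathrm{Sym}(\Omega)$. **Theorem.** Let $f$ be a permissible function and let $F_2$ be the free group with basis $\{a,b\}$. There are a set $\Omega(f)$ with a transitive action of $F_2$ and a point $\omega_0\in\Omega(f)$ such that, writing $\gamma(n)$ for the number of points of $\Omega(f)$ at distance at most $n$ from $\omega_0$ in the undirected path metric of the Schreier graph of the action with respect to $\{a,b\}$: 1. $\gamma\approx f$, and if $f(1)\le 3$ then $\gamma(n)=f(n)$ for all $n\in\mathbb{N}$; 2. the group $\Delta(f)=\mathcal{S}(F_2,\Omega(f))$ is finitely generated and LEF; 3. for every finite generating set $S$ of $\Delta(f)$, $\ \mathcal{L}_{\Delta(f)}^S(n)\approx f(n)!$. -/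

import Mathlib

open scoped Nat

/-- `π` restricts to a local embedding of the subset `F` of `Γ` into `Q`: it is injective on `F` and
multiplicative on those products of two elements of `F` that lie in `F`. Only the values of `π` on
`F` matter. -/
def IsLocalEmbedding {Γ Q : Type*} [Group Γ] [Group Q] (F : Set Γ) (π : Γ → Q) : Prop :=
  Set.InjOn π F ∧ ∀ g ∈ F, ∀ h ∈ F, g * h ∈ F → π (g * h) = π g * π h

/-- Local embeddability into finite groups. (Every finite group is isomorphic to one in `Type`.) -/
def IsLEF (Γ : Type*) [Group Γ] : Prop :=
  ∀ F : Set Γ, F.Finite →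
    ∃ (Q : Type) (_ : Group Q) (_ : Finite Q) (π : Γ → Q), IsLocalEmbedding F π

/-- The closed ball of radius `n` around `ω` in the (undirected) path metric of the Schreier graph
of the action of `Γ` on `Ω` with respect to `S`: one step goes from `x` to `s • x` or to `s⁻¹ • x`
for some `s ∈ S`. -/
def schreierBall {Γ Ω : Type*} [Group Γ] [MulAction Γ Ω] (S : Set Γ) (ω : Ω) : ℕ → Set Ω
  | 0 => {ω}
  | n + 1 => schreierBall S ω n ∪
      {y | ∃ x ∈ schreierBall S ω n, ∃ s ∈ S, y = s • x ∨ y = s⁻¹ • x}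

/-- The growth function of a Schreier graph. -/
noncomputable def schreierGrowth {Γ Ω : Type*} [Group Γ] [MulAction Γ Ω] (S : Set Γ) (ω : Ω)
    (n : ℕ) : ℕ∞ :=
  (schreierBall S ω n).encard

/-- The ball of radius `n` around `1` in the word metric defined by `S`, i.e. the ball in the
Schreier graph of the regular action. -/
def wordBall {Γ : Type*} [Group Γ] (S : Set Γ) (n : ℕ) : Set Γ :=
  schreierBall S (1 : Γ) n

/-- The LEF growth of `Γ` with respect to `S`: the least order of a finite group into which the ball
of radius `n` locally embeds, and `⊤` if there is none. -/
noncomputable def lefGrowth {Γ : Type*} [Group Γ] (S : Set Γ) (n : ℕ) : ℕ∞ :=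
  sInf {m : ℕ∞ | ∃ (Q : Type) (_ : Group Q) (_ : Finite Q) (π : Γ → Q),
    IsLocalEmbedding (wordBall S n) π ∧ m = (Nat.card Q : ℕ∞)}

/-- The comparison `F₁ ≼ F₂` of functions on `(0, ∞)`: there is `C > 0` with `F₁ x ≤ F₂ (C x)` for
all `x > 0`. The values of the functions outside `(0, ∞)` play no role. -/
def Dominated (F₁ F₂ : ℝ → ℕ∞) : Prop :=
  ∃ C : ℝ, 0 < C ∧ ∀ x : ℝ, 0 < x → F₁ x ≤ F₂ (C * x)

/-- The extension of a function on `ℕ` that is constant on each interval `[n, n + 1)`. -/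
noncomputable def stepExtension (u : ℕ → ℕ∞) (x : ℝ) : ℕ∞ :=
  u ⌊x⌋₊

/-- Equivalence `u₁ ≈ u₂` of functions on `ℕ`: their extensions dominate each other. -/
def GrowthEquiv (u₁ u₂ : ℕ → ℕ∞) : Prop :=
  Dominated (stepExtension u₁) (stepExtension u₂) ∧
    Dominated (stepExtension u₂) (stepExtension u₁)

/-- The group of finitely supported permutations of `Ω`. -/
def FSym (Ω : Type*) : Subgroup (Equiv.Perm Ω) where
  carrier := {σ | {x | σ x ≠ x}.Finite}
  one_mem' := by simp
  mul_mem' := by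
    intro σ τ hσ hτ
    refine (hσ.union hτ).subset ?_
    intro x hx
    by_contra h
    have h₁ : σ x = x := by_contra fun h' => h (Or.inl h')
    have h₂ : τ x = x := by_contra fun h' => h (Or.inr h')
    exact hx (by rw [Equiv.Perm.mul_apply, h₂, h₁])
  inv_mem' := by
    intro σ hσ
    refine Set.Finite.subset hσ ?_
    intro x hx h
    exact hx (Equiv.Perm.inv_eq_iff_eq.2 h.symm)

instance FSym.normal (Ω : Type*) : (FSym Ω).Normal where
  conj_mem := by
    intro σ hσ τ
    refine Set.Finite.subset (Set.Finite.image τ hσ) ?_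
    intro x hx
    refine ⟨τ⁻¹ x, fun h => hx ?_, by simp⟩
    rw [Equiv.Perm.mul_apply, Equiv.Perm.mul_apply, h]
    exact Equiv.apply_symm_apply τ x

/-- The action of `Γ` on `FSym Ω` by automorphisms induced by an action on `Ω`: `g` acts as
conjugation by the permutation `x ↦ g • x`. -/
noncomputable def enrichmentAction (Γ Ω : Type*) [Group Γ] [MulAction Γ Ω] :
    Γ →* MulAut (FSym Ω) :=
  MulAut.conjNormal.comp (MulAction.toPermHom Γ Ω)

/-- The symmetric enrichment `FSym(Ω) ⋊ Γ` of an action of `Γ` on `Ω`. -/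
abbrev SymmetricEnrichment (Γ Ω : Type*) [Group Γ] [MulAction Γ Ω] : Type _ :=
  SemidirectProduct (FSym Ω) Γ (enrichmentAction Γ Ω)

/-- Permissible functions. -/
def Permissible (f : ℕ → ℕ) : Prop :=
  StrictMono f ∧ f 0 = 1 ∧ ∀ n : ℕ, 1 ≤ n →
    ((f n : ℝ) - f (n - 1)) / 2 ≤ (f (n + 1) : ℝ) - f n ∧
      (f (n + 1) : ℝ) - f n ≤ 2 * ((f n : ℝ) - f (n - 1))

/-- The free basis `{a, b}` of the free group of rank two. -/
def freeBasis : Set (FreeGroup (Fin 2)) :=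
  Set.range FreeGroup.of

/-!
The growth of the Schreier graph is prescribed by building the graph level by level. Take `d n`
vertices at level `n`, where `d` is the sequence of differences of `f`, preceded by some powers of
`2` if `f 1 > 3`. Since `d (n + 1) ≤ 2 * d n`, each vertex of level `n` can be joined to at most
two vertices of level `n + 1` so that every vertex of level `n + 1` is joined to one; the
resulting blocks of two or three vertices are made cycles of `a` for even `n` and of `b` for odd
`n` (`levelPerm`). The ball of radius `n` around the root is then the set of vertices of level at
most `n` (`schreierBall_levelSet`).

Lower bound on the LEF growth. In any finite generating set, the transpositions of points of the
ball of radius `n` of the Schreier graph have length `O(n)`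
(`exists_enrichmentSwap_mem_wordBall`), because the transposition of `ω` and `s • y` is conjugate
to the one of `ω` and `y` by an element of bounded length. A local embedding of a ball of radius
`O(n)` into `Q` is therefore injective on these transpositions and compatible with conjugation
among them. Every permutation of the ball is a product of transpositions, so its action on
transpositions is induced by conjugation with an element of `Q`, which determines the permutation.
So `Q` has at least `m!` elements, where `m` is the number of points of the ball
(`factorial_card_le_of_transpositions`).

Upper bound on the LEF growth. Because the cycles of `a` and `b` stay within two consecutive
levels, the generators can be cut off at level `R` without disturbing lower levels
(`exists_truncatedAction`). If `R` is a large multiple of `n`, sending `(σ, w)` to the product of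
`σ` with the truncated action of `w` is multiplicative on the ball of radius `n`. It need not be
injective, which is repaired by recording also the image of `w` in `SL(2, ℤ/N)` under the Sanov
embedding of the free group, with `N` exponential in `n` (`isLocalEmbedding_enrichmentMap`,
`exists_finite_quotient_injOn_wordBall`). The extra exponential factor is harmless, as `m! * 2 ^ M
≤ (m + M)!` for `m ≥ 1` and `f (A) + M ≤ f (A + M)`. In particular all balls embed locally into
finite groups, so the symmetric enrichment is LEF. Finite generation follows from the transitivity
of the action (`fg_symmetricEnrichment`).
-/

/-! ### Balls in Schreier graphs -/

section Balls

variable {Γ Ω : Type*} [Group Γ] [MulAction Γ Ω] {S : Set Γ} {ω : Ω}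

lemma schreierBall_mono : Monotone (schreierBall S ω) :=
  monotone_nat_of_le_succ fun _ => Set.subset_union_left

lemma self_mem_schreierBall (n : ℕ) : ω ∈ schreierBall S ω n :=
  schreierBall_mono (Nat.zero_le n) rfl

lemma smul_mem_schreierBall {n : ℕ} {x : Ω} {s : Γ} (hs : s ∈ S)
    (hx : x ∈ schreierBall S ω n) : s • x ∈ schreierBall S ω (n + 1) :=
  Or.inr ⟨x, hx, s, hs, Or.inl rfl⟩

lemma inv_smul_mem_schreierBall {n : ℕ} {x : Ω} {s : Γ} (hs : s ∈ S)
    (hx : x ∈ schreierBall S ω n) : s⁻¹ • x ∈ schreierBall S ω (n + 1) :=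
  Or.inr ⟨x, hx, s, hs, Or.inr rfl⟩

lemma one_mem_wordBall (n : ℕ) : (1 : Γ) ∈ wordBall S n :=
  self_mem_schreierBall n

lemma wordBall_mono : Monotone (wordBall S) :=
  schreierBall_mono

lemma mem_wordBall_one {s : Γ} (hs : s ∈ S) : s ∈ wordBall S 1 := by
  have h : s • (1 : Γ) ∈ wordBall S 1 := smul_mem_schreierBall hs rfl
  simpa using h

lemma inv_mem_wordBall_one {s : Γ} (hs : s ∈ S) : s⁻¹ ∈ wordBall S 1 := by
  have h : s⁻¹ • (1 : Γ) ∈ wordBall S 1 := inv_smul_mem_schreierBall hs rfl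
  simpa using h

/-- Induction along a word: an element of a word ball is reached from `1` by successive left
multiplications with generators and their inverses. -/
lemma wordBall_induction {p : ℕ → Γ → Prop} (one : p 0 1)
    (succ : ∀ n g, p n g → p (n + 1) g)
    (mul : ∀ n g, p n g → ∀ s ∈ S, p (n + 1) (s * g) ∧ p (n + 1) (s⁻¹ * g))
    {n : ℕ} {g : Γ} (hg : g ∈ wordBall S n) : p n g := by
  induction n generalizing g with
  | zero =>
    obtain rfl : g = 1 := hg
    exact one
  | succ n ih =>
    rcases hg with hg | ⟨x, hx, s, hs, rfl | rfl⟩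
    · exact succ _ _ (ih hg)
    · exact (mul _ _ (ih hx) s hs).1
    · exact (mul _ _ (ih hx) s hs).2

lemma smul_mem_schreierBall_add {m n : ℕ} {g : Γ} {x : Ω} (hg : g ∈ wordBall S m)
    (hx : x ∈ schreierBall S ω n) : g • x ∈ schreierBall S ω (m + n) := by
  refine wordBall_induction (p := fun m g => g • x ∈ schreierBall S ω (m + n)) ?_ ?_ ?_ hg
  · simpa using hx
  · intro k g h
    exact schreierBall_mono (by omega) h
  · intro k g h s hs
    rw [mul_smul, mul_smul, Nat.add_right_comm]
    exact ⟨smul_mem_schreierBall hs h, inv_smul_mem_schreierBall hs h⟩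

lemma mul_mem_wordBall {m n : ℕ} {g h : Γ} (hg : g ∈ wordBall S m) (hh : h ∈ wordBall S n) :
    g * h ∈ wordBall S (m + n) :=
  smul_mem_schreierBall_add hg hh

lemma inv_mem_wordBall {n : ℕ} {g : Γ} (hg : g ∈ wordBall S n) : g⁻¹ ∈ wordBall S n := by
  refine wordBall_induction (p := fun n g => g⁻¹ ∈ wordBall S n) ?_ ?_ ?_ hg
  · simpa using one_mem_wordBall 0
  · intro k g h
    exact wordBall_mono (by omega) h
  · intro k g h s hs
    rw [mul_inv_rev, mul_inv_rev, inv_inv]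
    exact ⟨mul_mem_wordBall h (inv_mem_wordBall_one hs), mul_mem_wordBall h (mem_wordBall_one hs)⟩

lemma exists_mem_wordBall (hS : Subgroup.closure S = ⊤) (g : Γ) : ∃ n, g ∈ wordBall S n := by
  have hg : g ∈ Subgroup.closure S := hS ▸ Subgroup.mem_top g
  induction hg using Subgroup.closure_induction with
  | mem s hs => exact ⟨1, mem_wordBall_one hs⟩
  | one => exact ⟨0, one_mem_wordBall 0⟩
  | mul g h _ _ ihg ihh =>
    obtain ⟨m, hm⟩ := ihg
    obtain ⟨n, hn⟩ := ihh
    exact ⟨m + n, mul_mem_wordBall hm hn⟩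
  | inv g _ ih =>
    obtain ⟨n, hn⟩ := ih
    exact ⟨n, inv_mem_wordBall hn⟩

lemma exists_subset_wordBall (hS : Subgroup.closure S = ⊤) {F : Set Γ} (hF : F.Finite) :
    ∃ n, F ⊆ wordBall S n := by
  induction F, hF using Set.Finite.induction_on with
  | empty => exact ⟨0, Set.empty_subset _⟩
  | @insert g F _ _ ih =>
    obtain ⟨m, hm⟩ := ih
    obtain ⟨n, hn⟩ := exists_mem_wordBall hS g
    exact ⟨m + n, Set.insert_subset (wordBall_mono (by omega) hn)
      (hm.trans (wordBall_mono (by omega)))⟩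

lemma exists_mem_schreierBall [MulAction.IsPretransitive Γ Ω] (hS : Subgroup.closure S = ⊤)
    (x : Ω) : ∃ n, x ∈ schreierBall S ω n := by
  obtain ⟨g, rfl⟩ := MulAction.exists_smul_eq Γ ω x
  obtain ⟨n, hn⟩ := exists_mem_wordBall hS g
  exact ⟨n + 0, smul_mem_schreierBall_add hn rfl⟩

lemma exists_subset_schreierBall [MulAction.IsPretransitive Γ Ω] (hS : Subgroup.closure S = ⊤)
    {F : Set Ω} (hF : F.Finite) : ∃ n, F ⊆ schreierBall S ω n := by
  induction F, hF using Set.Finite.induction_on with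
  | empty => exact ⟨0, Set.empty_subset _⟩
  | @insert g F _ _ ih =>
    obtain ⟨m, hm⟩ := ih
    obtain ⟨n, hn⟩ := exists_mem_schreierBall (ω := ω) hS g
    exact ⟨m + n, Set.insert_subset (schreierBall_mono (by omega) hn)
      (hm.trans (schreierBall_mono (by omega)))⟩

end Balls

/-! ### Local embeddings -/

section LocalEmbedding

variable {Γ Q : Type*} [Group Γ] [Group Q] {F : Set Γ} {π : Γ → Q}

lemma IsLocalEmbedding.mono {F' : Set Γ} (h : IsLocalEmbedding F π) (hF : F' ⊆ F) :
    IsLocalEmbedding F' π :=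
  ⟨h.1.mono hF, fun g hg k hk hgk => h.2 g (hF hg) k (hF hk) (hF hgk)⟩

lemma IsLocalEmbedding.map_one (h : IsLocalEmbedding F π) (h1 : (1 : Γ) ∈ F) : π 1 = 1 := by
  simpa using h.2 1 h1 1 h1 (by simpa using h1)

end LocalEmbedding

/-! ### Transpositions in the symmetric enrichment -/

section Enrichment

variable {Γ Ω : Type*} [Group Γ] [MulAction Γ Ω]

@[simp]
lemma coe_enrichmentAction (g : Γ) (σ : FSym Ω) :
    ((enrichmentAction Γ Ω g σ : FSym Ω) : Equiv.Perm Ω) =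
      MulAction.toPermHom Γ Ω g * σ * (MulAction.toPermHom Γ Ω g)⁻¹ :=
  rfl

open Classical in
/-- The transposition of two points, as an element of the symmetric enrichment; it is `1` if the two
points coincide. -/
noncomputable def enrichmentSwap (Γ : Type*) {Ω : Type*} [Group Γ] [MulAction Γ Ω] (x y : Ω) :
    SymmetricEnrichment Γ Ω :=
  SemidirectProduct.inl ⟨Equiv.swap x y, (Set.toFinite {x, y}).subset fun z hz => by
    by_contra h
    simp only [Set.mem_insert_iff, Set.mem_singleton_iff, not_or] at h
    exact hz (Equiv.swap_apply_of_ne_of_ne h.1 h.2)⟩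

lemma enrichmentSwap_self (x : Ω) : enrichmentSwap Γ x x = 1 := by
  simp only [enrichmentSwap, Equiv.swap_self]
  exact map_one _

lemma enrichmentSwap_comm (x y : Ω) : enrichmentSwap Γ x y = enrichmentSwap Γ y x := by
  simp only [enrichmentSwap, Equiv.swap_comm]

lemma enrichmentSwap_mul_self (x y : Ω) : enrichmentSwap Γ x y * enrichmentSwap Γ x y = 1 := by
  classical
  rw [enrichmentSwap, ← map_mul]
  exact (congrArg SemidirectProduct.inl
    (Subtype.ext (a2 := (1 : FSym Ω)) (Equiv.swap_mul_self x y))).trans (map_one _)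

open Classical in
lemma enrichmentSwap_conj (x y u v : Ω) :
    enrichmentSwap Γ x y * enrichmentSwap Γ u v * enrichmentSwap Γ x y =
      enrichmentSwap Γ (Equiv.swap x y u) (Equiv.swap x y v) := by
  simp only [enrichmentSwap]
  rw [← map_mul, ← map_mul]
  congr 1
  apply Subtype.ext
  have h := Equiv.swap_apply_apply (Equiv.swap x y) u v
  rw [Equiv.swap_inv] at h
  exact h.symm

lemma inr_conj_enrichmentSwap (g : Γ) (x y : Ω) :
    SemidirectProduct.inr g * enrichmentSwap Γ x y * SemidirectProduct.inr g⁻¹ =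
      enrichmentSwap Γ (g • x) (g • y) := by
  classical
  simp only [enrichmentSwap]
  rw [← SemidirectProduct.inl_aut]
  congr 1
  apply Subtype.ext
  exact (Equiv.swap_apply_apply (MulAction.toPermHom Γ Ω g) x y).symm

/-- Distinct unordered pairs of distinct points give distinct transpositions. -/
lemma enrichmentSwap_inj {x y u v : Ω} (hxy : x ≠ y)
    (h : enrichmentSwap Γ x y = enrichmentSwap Γ u v) : x = u ∧ y = v ∨ x = v ∧ y = u := by
  classical
  have h' : Equiv.swap x y = Equiv.swap u v :=
    congrArg Subtype.val (SemidirectProduct.inl_injective h)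
  have hx := Equiv.congr_fun h' x
  have hy := Equiv.congr_fun h' y
  rw [Equiv.swap_apply_left, Equiv.swap_apply_def] at hx
  rw [Equiv.swap_apply_right, Equiv.swap_apply_def] at hy
  grind

/-- The elementary step in bounding the length of a transposition: up to conjugation by a fixed
element, the transposition of `ω` and `g • y` is the one of `ω` and `y`. -/
lemma enrichmentSwap_smul (ω y : Ω) (g : Γ) (h₁ : g • y ≠ ω) (h₂ : g • y ≠ g • ω) :
    enrichmentSwap Γ ω (g • y) = enrichmentSwap Γ ω (g • ω) *
      (SemidirectProduct.inr g * enrichmentSwap Γ ω y * SemidirectProduct.inr g⁻¹) *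
        enrichmentSwap Γ ω (g • ω) := by
  classical
  rw [inr_conj_enrichmentSwap, enrichmentSwap_conj, Equiv.swap_apply_right,
    Equiv.swap_apply_of_ne_of_ne h₁ h₂]

end Enrichment

/-! ### Finite generation -/

section Generation

variable {Γ Ω : Type*} [Group Γ] [MulAction Γ Ω] [MulAction.IsPretransitive Γ Ω]

/-- The symmetric enrichment of a transitive action of a finitely generated group is finitely
generated: by generators of the group and the transpositions moving a base point to a neighbour. -/
theorem fg_symmetricEnrichment [Group.FG Γ] (ω : Ω) : Group.FG (SymmetricEnrichment Γ Ω) := by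
  classical
  obtain ⟨T, hT⟩ := Group.fg_iff.1 ‹Group.FG Γ›
  let E : Set (SymmetricEnrichment Γ Ω) :=
    SemidirectProduct.inr '' T ∪ (fun s => enrichmentSwap Γ ω (s • ω)) '' T
  let H := Subgroup.closure E
  have hinr (g : Γ) : (SemidirectProduct.inr g : SymmetricEnrichment Γ Ω) ∈ H := by
    have hg : g ∈ Subgroup.closure T := hT.1 ▸ Subgroup.mem_top g
    induction hg using Subgroup.closure_induction with
    | mem s hs => exact Subgroup.subset_closure (Or.inl ⟨s, hs, rfl⟩)
    | one => rw [map_one]; exact H.one_mem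
    | mul g h _ _ ihg ihh => rw [map_mul]; exact H.mul_mem ihg ihh
    | inv g _ ih => rw [map_inv]; exact H.inv_mem ih
  have hsmul (g : Γ) {x y : Ω} (h : enrichmentSwap Γ x y ∈ H) :
      enrichmentSwap Γ (g • x) (g • y) ∈ H := by
    rw [← inr_conj_enrichmentSwap]
    exact H.mul_mem (H.mul_mem (hinr _) h) (hinr _)
  have htrans {x y z : Ω} (h₁ : enrichmentSwap Γ x y ∈ H) (h₂ : enrichmentSwap Γ y z ∈ H) :
      enrichmentSwap Γ x z ∈ H := by
    by_cases hx : z = x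
    · rw [hx, enrichmentSwap_self]; exact H.one_mem
    by_cases hy : z = y
    · rwa [hy]
    have h := H.mul_mem (H.mul_mem h₁ h₂) h₁
    rwa [enrichmentSwap_conj, Equiv.swap_apply_right, Equiv.swap_apply_of_ne_of_ne hx hy] at h
  have hbase (g : Γ) : enrichmentSwap Γ ω (g • ω) ∈ H := by
    have hg : g ∈ Subgroup.closure T := hT.1 ▸ Subgroup.mem_top g
    induction hg using Subgroup.closure_induction with
    | mem s hs => exact Subgroup.subset_closure (Or.inr ⟨s, hs, rfl⟩)
    | one => rw [one_smul, enrichmentSwap_self]; exact H.one_mem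
    | mul g h _ _ ihg ihh =>
      rw [mul_smul]
      exact htrans ihg (hsmul g ihh)
    | inv g _ ih =>
      have h := hsmul g⁻¹ ih
      rwa [inv_smul_smul, enrichmentSwap_comm] at h
  have hswap (x y : Ω) : enrichmentSwap Γ x y ∈ H := by
    obtain ⟨g, rfl⟩ := MulAction.exists_smul_eq Γ ω x
    obtain ⟨h, rfl⟩ := MulAction.exists_smul_eq Γ ω y
    exact htrans (by rw [enrichmentSwap_comm]; exact hbase g) (hbase h)
  -- A finitely supported permutation is a product of transpositions.
  have hinl (σ : FSym Ω) : (SemidirectProduct.inl σ : SymmetricEnrichment Γ Ω) ∈ H := by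
    let K : Subgroup (Equiv.Perm Ω) :=
      (H.comap (SemidirectProduct.inl : FSym Ω →* SymmetricEnrichment Γ Ω)).map (FSym Ω).subtype
    have hσ : (σ : Equiv.Perm Ω) ∈ Subgroup.closure {τ : Equiv.Perm Ω | τ.IsSwap} := by
      rw [mem_closure_isSwap']
      exact σ.2
    have hle : Subgroup.closure {τ : Equiv.Perm Ω | τ.IsSwap} ≤ K := by
      rw [Subgroup.closure_le]
      rintro _ ⟨x, y, -, rfl⟩
      exact ⟨_, hswap x y, rfl⟩
    obtain ⟨τ, hτ, h⟩ := hle hσ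
    obtain rfl : τ = σ := Subtype.ext h
    exact hτ
  rw [Group.fg_iff]
  refine ⟨E, ?_, (hT.2.image _).union (hT.2.image _)⟩
  rw [eq_top_iff]
  intro g _
  rw [← SemidirectProduct.inl_left_mul_inr_right g]
  exact H.mul_mem (hinl _) (hinr _)

end Generation

/-! ### The lower bound on the LEF growth -/

section LowerBound

variable {Γ Ω : Type*} [Group Γ] [MulAction Γ Ω]

/-- Transpositions of points in a ball of the Schreier graph have length at most linear in the
radius. -/
lemma exists_enrichmentSwap_mem_wordBall {T : Set Γ} (hT : T.Finite) (ω : Ω)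
    {S : Set (SymmetricEnrichment Γ Ω)} (hS : Subgroup.closure S = ⊤) :
    ∃ C : ℕ, ∀ n, ∀ x ∈ schreierBall T ω n, ∀ y ∈ schreierBall T ω n,
      enrichmentSwap Γ x y ∈ wordBall S (C * n) := by
  classical
  obtain ⟨K, hK⟩ := exists_subset_wordBall hS
    (((hT.image SemidirectProduct.inr).union (hT.image fun s => enrichmentSwap Γ ω (s • ω))).union
      (hT.image fun s => enrichmentSwap Γ ω (s⁻¹ • ω)))
  have step {n : ℕ} {g : Γ} {y : Ω} (hg : SemidirectProduct.inr g ∈ wordBall S K)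
      (ht : enrichmentSwap Γ ω (g • ω) ∈ wordBall S K)
      (hy : enrichmentSwap Γ ω y ∈ wordBall S (4 * K * n)) :
      enrichmentSwap Γ ω (g • y) ∈ wordBall S (4 * K * (n + 1)) := by
    by_cases h₁ : g • y = ω
    · rw [h₁, enrichmentSwap_self]; exact one_mem_wordBall _
    by_cases h₂ : g • y = g • ω
    · rw [h₂]; exact wordBall_mono (by nlinarith) ht
    rw [enrichmentSwap_smul ω y g h₁ h₂]
    have hg' := inv_mem_wordBall hg
    rw [← map_inv] at hg'
    exact wordBall_mono (by linarith)
      (mul_mem_wordBall (mul_mem_wordBall ht (mul_mem_wordBall (mul_mem_wordBall hg hy) hg')) ht)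
  have hbase (n : ℕ) : ∀ y ∈ schreierBall T ω n,
      enrichmentSwap Γ ω y ∈ wordBall S (4 * K * n) := by
    induction n with
    | zero =>
      rintro y rfl
      rw [enrichmentSwap_self]
      exact one_mem_wordBall _
    | succ n ih =>
      rintro y (hy | ⟨x, hx, s, hs, rfl | rfl⟩)
      · exact wordBall_mono (by nlinarith) (ih y hy)
      · exact step (hK (Or.inl (Or.inl ⟨s, hs, rfl⟩))) (hK (Or.inl (Or.inr ⟨s, hs, rfl⟩)))
          (ih x hx)
      · refine step ?_ (hK (Or.inr ⟨s, hs, rfl⟩)) (ih x hx)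
        rw [map_inv]
        exact inv_mem_wordBall (hK (Or.inl (Or.inl ⟨s, hs, rfl⟩)))
  refine ⟨12 * K, fun n x hx y hy => ?_⟩
  by_cases hxy : y = x
  · rw [hxy, enrichmentSwap_self]; exact one_mem_wordBall _
  by_cases hyω : y = ω
  · rw [hyω, enrichmentSwap_comm]
    exact wordBall_mono (by nlinarith) (hbase n x hx)
  have h := enrichmentSwap_conj (Γ := Γ) ω x ω y
  rw [Equiv.swap_apply_left, Equiv.swap_apply_of_ne_of_ne hyω hxy] at h
  rw [← h]
  exact wordBall_mono (by linarith)
    (mul_mem_wordBall (mul_mem_wordBall (hbase n x hx) (hbase n y hy)) (hbase n x hx))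

open Classical in
/-- A finite group that receives the transpositions of a finite set `X` injectively, and compatibly
with conjugation, has at least `|X|!` elements: every permutation of `X` is induced by conjugation
with some element of the group, and is determined by that element as soon as `|X| ≥ 3`. -/
lemma factorial_card_le_of_transpositions {X Q : Type*} [Fintype X] [Group Q] [Finite Q]
    (t : X → X → Q) (hinv : ∀ x y, t x y * t x y = 1)
    (hconj : ∀ x y u v, t x y * t u v * t x y = t (Equiv.swap x y u) (Equiv.swap x y v))
    (hinj : ∀ x y u v, x ≠ y → t x y = t u v → x = u ∧ y = v ∨ x = v ∧ y = u)
    (hone : ∀ x y, x ≠ y → t x y ≠ 1) :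
    (Fintype.card X)! ≤ Nat.card Q := by
  have hQ (σ : Equiv.Perm X) : ∃ q : Q, ∀ u v, q * t u v * q⁻¹ = t (σ u) (σ v) := by
    induction σ using Equiv.Perm.swap_induction_on with
    | one => exact ⟨1, fun u v => by simp⟩
    | swap_mul σ x y _ ih =>
      obtain ⟨q, hq⟩ := ih
      refine ⟨t x y * q, fun u v => ?_⟩
      rw [Equiv.Perm.mul_apply, Equiv.Perm.mul_apply, ← hconj, ← hq, mul_inv_rev,
        inv_eq_of_mul_eq_one_right (hinv x y)]
      group
  -- A set of two points has only one transposition, so conjugation does not separate its permutations.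
  rcases Nat.lt_or_ge (Fintype.card X) 3 with hX | hX
  · rcases Nat.lt_or_ge (Fintype.card X) 2 with hX' | hX'
    · rw [Nat.factorial_eq_one.2 (by omega)]
      exact Nat.card_pos
    · obtain ⟨x, y, hxy⟩ := Fintype.one_lt_card_iff.1 (show 1 < Fintype.card X by omega)
      have : Nontrivial Q := ⟨⟨_, _, hone x y hxy⟩⟩
      have h2 : Fintype.card X = 2 := by omega
      rw [h2]
      exact Finite.one_lt_card
  choose q hq using hQ
  rw [← Fintype.card_perm, ← Nat.card_eq_fintype_card]
  refine Nat.card_le_card_of_injective q fun σ τ hστ => Equiv.ext fun x => ?_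
  have key (u v : X) (huv : u ≠ v) : σ u = τ u ∧ σ v = τ v ∨ σ u = τ v ∧ σ v = τ u :=
    hinj _ _ _ _ (σ.injective.ne huv) (by rw [← hq, ← hq, hστ])
  -- The point `x` is recovered from the images of two transpositions `(x y)` and `(x z)`.
  obtain ⟨y, hy⟩ := Fintype.exists_ne_of_one_lt_card (show 1 < Fintype.card X by omega) x
  have hcard : ({x, y} : Finset X).card < Fintype.card X :=
    (Finset.card_le_two).trans_lt (by omega)
  obtain ⟨z, hz⟩ : ∃ z, z ∉ ({x, y} : Finset X) := by
    by_contra! h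
    exact absurd (Finset.card_eq_iff_eq_univ _ |>.2 (Finset.eq_univ_iff_forall.2 h)) hcard.ne
  simp only [Finset.mem_insert, Finset.mem_singleton, not_or] at hz
  rcases key x y hy.symm with h | h
  · exact h.1
  rcases key x z (Ne.symm hz.1) with h' | h'
  · exact h'.1
  · exact absurd (τ.injective (h.1.symm.trans h'.1)).symm hz.2

/-- A finite group receiving a ball of large enough radius, linear in `n`, receives all transpositions
of points in the ball of radius `n` of the Schreier graph, together with the products of three of them
needed to express conjugation. -/
theorem exists_factorial_le_lefGrowth {T : Set Γ} (hT : T.Finite) (ω : Ω) {g : ℕ → ℕ}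
    (hg : ∀ n, schreierGrowth T ω n = g n)
    {S : Set (SymmetricEnrichment Γ Ω)} (hS : Subgroup.closure S = ⊤) :
    ∃ C : ℕ, ∀ n, (((g n)! : ℕ) : ℕ∞) ≤ lefGrowth S (C * n) := by
  classical
  obtain ⟨C, hC⟩ := exists_enrichmentSwap_mem_wordBall hT ω hS
  refine ⟨3 * C, fun n => le_sInf ?_⟩
  rintro m ⟨Q, _, _, π, hπ, rfl⟩
  have hfin : (schreierBall T ω n).Finite := Set.finite_of_encard_eq_coe (hg n)
  have := hfin.fintype
  have hcard : Fintype.card (schreierBall T ω n) = g n := by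
    rw [← Nat.card_eq_fintype_card, Nat.card_coe_set_eq, Set.ncard_def]
    exact congrArg ENat.toNat (hg n)
  have hone := hπ.map_one (one_mem_wordBall _)
  have hmem (x y : schreierBall T ω n) : enrichmentSwap Γ (x : Ω) y ∈ wordBall S (C * n) :=
    hC n x x.2 y y.2
  have hle : wordBall S (C * n) ⊆ wordBall S (3 * C * n) := wordBall_mono (by nlinarith)
  have hswap (x y u : schreierBall T ω n) :
      Equiv.swap (x : Ω) y u = (Equiv.swap x y u : schreierBall T ω n) := by
    simp only [Equiv.swap_apply_def, Subtype.ext_iff]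
    split_ifs <;> rfl
  rw [Nat.cast_le, ← hcard]
  refine factorial_card_le_of_transpositions (fun x y => π (enrichmentSwap Γ (x : Ω) y))
    ?_ ?_ ?_ ?_
  · intro x y
    rw [← hπ.2 _ (hle (hmem x y)) _ (hle (hmem x y)), enrichmentSwap_mul_self, hone]
    rw [enrichmentSwap_mul_self]
    exact one_mem_wordBall _
  · intro x y u v
    have h₂ : enrichmentSwap Γ (x : Ω) y * enrichmentSwap Γ (u : Ω) v ∈ wordBall S (3 * C * n) :=
      wordBall_mono (by nlinarith) (mul_mem_wordBall (hmem x y) (hmem u v))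
    have h₃ := hmem (Equiv.swap x y u) (Equiv.swap x y v)
    rw [← hswap, ← hswap, ← enrichmentSwap_conj] at h₃
    rw [← hπ.2 _ (hle (hmem x y)) _ (hle (hmem u v)) h₂,
      ← hπ.2 _ h₂ _ (hle (hmem x y)) (hle h₃), enrichmentSwap_conj, hswap, hswap]
    congr!
  · intro x y u v hxy h
    have h' := hπ.1 (hle (hmem x y)) (hle (hmem u v)) h
    simpa only [Subtype.ext_iff] using enrichmentSwap_inj (by simpa [Subtype.ext_iff] using hxy) h'
  · intro x y hxy h
    have h' := hπ.1 (hle (hmem x y)) (one_mem_wordBall _) (h.trans hone.symm)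
    rw [← enrichmentSwap_self (x : Ω)] at h'
    have := enrichmentSwap_inj (by simpa [Subtype.ext_iff] using hxy) h'
    exact hxy (Subtype.ext (by rcases this with h | h <;> exact h.2.symm))

end LowerBound

/-! ### Local embeddings of symmetric enrichments -/

section UpperBound

/-- Two permutations that agree on the support of `τ` conjugate `τ` to the same permutation. -/
lemma conj_eq_conj_of_eqOn_support {Ω : Type*} {α β τ : Equiv.Perm Ω}
    (h : ∀ x, τ x ≠ x → α x = β x) : α * τ * α⁻¹ = β * τ * β⁻¹ := by
  have hd : Equiv.Perm.Disjoint (β⁻¹ * α) τ := fun x => by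
    by_cases hx : τ x = x
    · exact Or.inr hx
    · left
      rw [Equiv.Perm.mul_apply, h x hx, Equiv.Perm.inv_eq_iff_eq]
  have hc : β⁻¹ * α * τ = τ * (β⁻¹ * α) := hd.commute
  calc α * τ * α⁻¹ = β * (β⁻¹ * α * τ) * α⁻¹ := by group
    _ = β * τ * β⁻¹ := by rw [hc]; group

variable {Γ Ω P : Type*} [Group Γ] [MulAction Γ Ω] [Group P]

/-- The map on the symmetric enrichment induced by a second action `ρ` of the group and by a
homomorphism `θ`: it sends `(σ, w)` to `(σ * ρ w, θ w)`. The first factor of the target consists of the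
permutations of `Ω` that are trivial outside `X`; elements with `σ * ρ w` not of that kind are sent
to the junk value `1`. -/
noncomputable def enrichmentMap (X : Set Ω) (ρ : Γ →* Equiv.Perm Ω) (θ : Γ →* P)
    (g : SymmetricEnrichment Γ Ω) : fixingSubgroup (Equiv.Perm Ω) Xᶜ × P :=
  open Classical in
  if h : (g.left : Equiv.Perm Ω) * ρ g.right ∈ fixingSubgroup (Equiv.Perm Ω) Xᶜ then
    (⟨_, h⟩, θ g.right) else 1

/-- Suppose that `ρ` moves no point outside `X`, agrees with the given action on a large ball, and `θ`
is injective on a ball of `Γ`. Then `enrichmentMap` is a local embedding of the set of those elements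
whose two components live in the respective balls. -/
lemma isLocalEmbedding_enrichmentMap {T : Set Γ} {ω : Ω} {X : Set Ω} {r : ℕ}
    {ρ : Γ →* Equiv.Perm Ω} {θ : Γ →* P} (hX : schreierBall T ω r ⊆ X)
    (hρX : ∀ g, ∀ x ∉ X, ρ g x = x)
    (hρ : ∀ g ∈ wordBall T r, ∀ x ∈ schreierBall T ω r, ρ g x = g • x)
    (hθ : Set.InjOn θ (wordBall T r)) :
    IsLocalEmbedding {g : SymmetricEnrichment Γ Ω |
      {x | (g.left : Equiv.Perm Ω) x ≠ x} ⊆ schreierBall T ω r ∧ g.right ∈ wordBall T r}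
      (enrichmentMap X ρ θ) := by
  have hmem (g : SymmetricEnrichment Γ Ω)
      (hg : {x | (g.left : Equiv.Perm Ω) x ≠ x} ⊆ schreierBall T ω r) :
      (g.left : Equiv.Perm Ω) * ρ g.right ∈ fixingSubgroup (Equiv.Perm Ω) Xᶜ := by
    rw [mem_fixingSubgroup_iff]
    intro x hx
    rw [Equiv.Perm.smul_def, Equiv.Perm.mul_apply, hρX _ x hx]
    by_contra h
    exact hx (hX (hg h))
  have hval (g : SymmetricEnrichment Γ Ω)
      (hg : {x | (g.left : Equiv.Perm Ω) x ≠ x} ⊆ schreierBall T ω r) :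
      enrichmentMap X ρ θ g = (⟨_, hmem g hg⟩, θ g.right) := dif_pos (hmem g hg)
  refine ⟨?_, ?_⟩
  · rintro g ⟨hg₁, hg₂⟩ h ⟨hh₁, hh₂⟩ heq
    rw [hval g hg₁, hval h hh₁, Prod.mk.injEq, Subtype.mk.injEq] at heq
    have hright : g.right = h.right := hθ hg₂ hh₂ heq.2
    refine SemidirectProduct.ext (Subtype.ext ?_) hright
    have h₁ := heq.1
    rwa [hright, mul_left_inj] at h₁
  · rintro g ⟨hg₁, hg₂⟩ h ⟨hh₁, hh₂⟩ ⟨hgh₁, hgh₂⟩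
    rw [hval g hg₁, hval h hh₁, hval _ hgh₁, Prod.mk_mul_mk]
    refine Prod.ext (Subtype.ext ?_) ?_
    · have hconj := conj_eq_conj_of_eqOn_support (τ := (h.left : Equiv.Perm Ω))
        (α := MulAction.toPermHom Γ Ω g.right) (β := ρ g.right)
        fun x hx => (hρ _ hg₂ x (hh₁ hx)).symm
      simp only [SemidirectProduct.mul_left, SemidirectProduct.mul_right, Subgroup.coe_mul,
        coe_enrichmentAction, map_mul]
      rw [hconj]
      group
    · simp

/-- Elements of length `n` in a finitely generated symmetric enrichment have their two components in
balls of radius linear in `n`. -/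
lemma exists_wordBall_subset [MulAction.IsPretransitive Γ Ω] {T : Set Γ}
    (hT : Subgroup.closure T = ⊤) (ω : Ω) {S : Set (SymmetricEnrichment Γ Ω)} (hS : S.Finite) :
    ∃ K : ℕ, ∀ n, wordBall S n ⊆ {g : SymmetricEnrichment Γ Ω |
      {x | (g.left : Equiv.Perm Ω) x ≠ x} ⊆ schreierBall T ω (K * n) ∧
        g.right ∈ wordBall T (K * n)} := by
  -- Inverses are included because the support of `(s⁻¹).left` is not that of `s.left`.
  let S' : Set (SymmetricEnrichment Γ Ω) := S ∪ Inv.inv '' S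
  have hS' : S'.Finite := hS.union (hS.image _)
  obtain ⟨K₁, hK₁⟩ := exists_subset_wordBall hT
    (hS'.image (SemidirectProduct.rightHom : SymmetricEnrichment Γ Ω →* Γ))
  obtain ⟨K₂, hK₂⟩ := exists_subset_schreierBall (ω := ω) hT
    (hS'.biUnion fun g _ => g.left.2)
  have step {n : ℕ} {g s : SymmetricEnrichment Γ Ω} (hs : s ∈ S')
      (hg : {x | (g.left : Equiv.Perm Ω) x ≠ x} ⊆ schreierBall T ω ((K₁ + K₂) * n) ∧
        g.right ∈ wordBall T ((K₁ + K₂) * n)) :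
      {x | ((s * g).left : Equiv.Perm Ω) x ≠ x} ⊆ schreierBall T ω ((K₁ + K₂) * (n + 1)) ∧
        (s * g).right ∈ wordBall T ((K₁ + K₂) * (n + 1)) := by
    have hsr : s.right ∈ wordBall T K₁ := hK₁ ⟨s, hs, rfl⟩
    refine ⟨fun x hx => ?_, wordBall_mono (by nlinarith) (mul_mem_wordBall hsr hg.2)⟩
    by_cases h : (g.left : Equiv.Perm Ω) (s.right⁻¹ • x) = s.right⁻¹ • x
    · have h' : (s.left : Equiv.Perm Ω) x ≠ x := fun h' => hx <| by
        rw [SemidirectProduct.mul_left, Subgroup.coe_mul, coe_enrichmentAction,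
          ← map_inv, Equiv.Perm.mul_apply, Equiv.Perm.mul_apply, Equiv.Perm.mul_apply,
          MulAction.toPermHom_apply, MulAction.toPermHom_apply, MulAction.toPerm_apply,
          MulAction.toPerm_apply, h, smul_inv_smul, h']
      exact schreierBall_mono (by nlinarith) (hK₂ (Set.mem_biUnion hs h'))
    · have hmem := smul_mem_schreierBall_add hsr (hg.1 h)
      rw [smul_inv_smul] at hmem
      exact schreierBall_mono (by nlinarith) hmem
  refine ⟨K₁ + K₂, fun n g hg => ?_⟩
  refine wordBall_induction (p := fun n (g : SymmetricEnrichment Γ Ω) =>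
    {x | (g.left : Equiv.Perm Ω) x ≠ x} ⊆ schreierBall T ω ((K₁ + K₂) * n) ∧
      g.right ∈ wordBall T ((K₁ + K₂) * n)) ?_ ?_ ?_ hg
  · exact ⟨fun x hx => absurd rfl hx, one_mem_wordBall _⟩
  · intro n g h
    exact ⟨h.1.trans (schreierBall_mono (by nlinarith)), wordBall_mono (by nlinarith) h.2⟩
  · intro n g h s hs
    exact ⟨step (Or.inl hs) h, step (Or.inr ⟨s, hs, rfl⟩) h⟩

lemma card_fixingSubgroup_compl (X : Set Ω) [Finite X] :
    Nat.card (fixingSubgroup (Equiv.Perm Ω) Xᶜ) = (Nat.card X)! := by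
  classical
  have e : fixingSubgroup (Equiv.Perm Ω) Xᶜ ≃ Equiv.Perm X :=
    (Equiv.subtypeEquivRight fun σ => by
      rw [mem_fixingSubgroup_iff]; rfl).trans (Equiv.Perm.subtypeEquivSubtypePerm (· ∈ X)).symm
  rw [Nat.card_congr e, Nat.card_perm]

/-- If `ρ` and the given action agree for the generators on a ball, they agree for short words on a
smaller ball. -/
lemma apply_eq_smul_of_mem_wordBall {T : Set Γ} {ω : Ω} {R : ℕ} {ρ : Γ →* Equiv.Perm Ω}
    (hρ : ∀ s ∈ T, ∀ x ∈ schreierBall T ω R, ρ s x = s • x ∧ ρ s⁻¹ x = s⁻¹ • x)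
    {m n : ℕ} (hmn : m + n ≤ R + 1) {g : Γ} (hg : g ∈ wordBall T m) {x : Ω}
    (hx : x ∈ schreierBall T ω n) : ρ g x = g • x := by
  have h : ρ g x = g • x ∧ g • x ∈ schreierBall T ω (m + n) := by
    refine wordBall_induction (p := fun m g => m + n ≤ R + 1 → ρ g x = g • x ∧
      g • x ∈ schreierBall T ω (m + n)) ?_ ?_ ?_ hg hmn
    · intro _
      simpa using hx
    · intro k g ih hk
      have ih := ih (by omega)
      exact ⟨ih.1, schreierBall_mono (by omega) ih.2⟩
    · intro k g ih s hs
      rw [map_mul, map_mul, Equiv.Perm.mul_apply, Equiv.Perm.mul_apply, mul_smul, mul_smul]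
      refine ⟨fun hk => ?_, fun hk => ?_⟩ <;> have ih := ih (by omega) <;>
        have hR := hρ s hs _ (schreierBall_mono (by omega) ih.2) <;> rw [ih.1] <;>
        rw [Nat.add_right_comm]
      · exact ⟨hR.1, smul_mem_schreierBall hs ih.2⟩
      · exact ⟨hR.2, inv_smul_mem_schreierBall hs ih.2⟩
  exact h.1

end UpperBound

/-! ### Finite quotients of the free group of rank two -/

section Sanov

/-- The two unipotent matrices generating the Sanov subgroup of `SL(2, ℤ)`. -/
def sanovMatrix (i : Fin 2) : Matrix.SpecialLinearGroup (Fin 2) ℤ :=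
  if i = 0 then ⟨!![1, 2; 0, 1], by simp⟩ else ⟨!![1, 0; 2, 1], by simp⟩

lemma coe_sanovMatrix (i : Fin 2) :
    (sanovMatrix i : Matrix (Fin 2) (Fin 2) ℤ) =
      if i = 0 then !![1, 2; 0, 1] else !![1, 0; 2, 1] := by
  fin_cases i <;> rfl

lemma coe_sanovMatrix_inv (i : Fin 2) :
    (((sanovMatrix i)⁻¹ : Matrix.SpecialLinearGroup (Fin 2) ℤ) : Matrix (Fin 2) (Fin 2) ℤ) =
      if i = 0 then !![1, -2; 0, 1] else !![1, 0; -2, 1] := by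
  rw [Matrix.SpecialLinearGroup.coe_inv, coe_sanovMatrix]
  split_ifs <;> simp [Matrix.adjugate_fin_two_of]

/-- The homomorphism from the free group of rank two onto the Sanov subgroup. -/
def sanovHom : FreeGroup (Fin 2) →* Matrix.SpecialLinearGroup (Fin 2) ℤ :=
  FreeGroup.lift sanovMatrix

/-- The integer vectors with odd first and even second coordinate. The Sanov subgroup preserves this
set, and no vector in it has coordinates of equal absolute value. -/
abbrev OddEvenVector : Type := {v : ℤ × ℤ // v.1 % 2 = 1 ∧ v.2 % 2 = 0}

/-- The action of the two matrices of `sanovMatrix` on the vectors of `OddEvenVector`. -/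
def sanovShear (i : Fin 2) : Equiv.Perm OddEvenVector :=
  if i = 0 then
    { toFun := fun v => ⟨(v.1.1 + 2 * v.1.2, v.1.2), by have := v.2; simp only; omega⟩
      invFun := fun v => ⟨(v.1.1 - 2 * v.1.2, v.1.2), by have := v.2; simp only; omega⟩
      left_inv := fun v => Subtype.ext (Prod.ext (by simp) rfl)
      right_inv := fun v => Subtype.ext (Prod.ext (by simp) rfl) }
  else
    { toFun := fun v => ⟨(v.1.1, 2 * v.1.1 + v.1.2), by have := v.2; simp only; omega⟩
      invFun := fun v => ⟨(v.1.1, v.1.2 - 2 * v.1.1), by have := v.2; simp only; omega⟩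
      left_inv := fun v => Subtype.ext (Prod.ext rfl (by simp))
      right_inv := fun v => Subtype.ext (Prod.ext rfl (by simp)) }

/-- The attracting set of the shear `sanovShear i`. -/
def sanovAttracting (i : Fin 2) : Set OddEvenVector :=
  if i = 0 then {v | |v.1.2| < |v.1.1| ∧ (0 < v.1.1 ∧ 0 < v.1.2 ∨ v.1.1 < 0 ∧ v.1.2 < 0)}
  else {v | |v.1.1| < |v.1.2| ∧ (0 < v.1.1 ∧ 0 < v.1.2 ∨ v.1.1 < 0 ∧ v.1.2 < 0)}

/-- The attracting set of the inverse of `sanovShear i`. -/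
def sanovRepelling (i : Fin 2) : Set OddEvenVector :=
  if i = 0 then {v | |v.1.2| < |v.1.1| ∧ ¬(0 < v.1.1 ∧ 0 < v.1.2 ∨ v.1.1 < 0 ∧ v.1.2 < 0)}
  else {v | |v.1.1| < |v.1.2| ∧ ¬(0 < v.1.1 ∧ 0 < v.1.2 ∨ v.1.1 < 0 ∧ v.1.2 < 0)}

/-- The shears generate a free group, by the ping-pong lemma. -/
lemma injective_lift_sanovShear : Function.Injective (FreeGroup.lift sanovShear) := by
  refine FreeGroup.injective_lift_of_ping_pong sanovShear sanovAttracting sanovRepelling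
    ?_ ?_ ?_ ?_ ?_ ?_
  · intro i
    fin_cases i
    · exact ⟨⟨(3, 2), by norm_num⟩, by norm_num [sanovAttracting]⟩
    · exact ⟨⟨(1, 2), by norm_num⟩, by norm_num [sanovAttracting]⟩
  · intro i j hij
    rw [Function.onFun, Set.disjoint_left]
    intro v hi hj
    fin_cases i <;> fin_cases j <;> simp [sanovAttracting] at hij hi hj <;> omega
  · intro i j hij
    rw [Function.onFun, Set.disjoint_left]
    intro v hi hj
    fin_cases i <;> fin_cases j <;> simp [sanovRepelling] at hij hi hj <;> omega
  · intro i j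
    rw [Set.disjoint_left]
    intro v hi hj
    fin_cases i <;> fin_cases j <;> simp [sanovAttracting, sanovRepelling] at hi hj <;> omega
  · intro i
    rintro _ ⟨⟨⟨x, y⟩, hx, hy⟩, hv, rfl⟩
    simp only at hx hy
    fin_cases i <;> simp [sanovAttracting, sanovRepelling, sanovShear] at hv ⊢ <;> grind
  · intro i
    rintro _ ⟨⟨⟨x, y⟩, hx, hy⟩, hv, rfl⟩
    simp only at hx hy
    fin_cases i <;>
      simp [sanovAttracting, sanovRepelling, sanovShear, Equiv.Perm.inv_def] at hv ⊢ <;> grind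

lemma lift_sanovShear_apply (w : FreeGroup (Fin 2)) (v : OddEvenVector) :
    (FreeGroup.lift sanovShear w v).1 =
      ((sanovHom w).1 0 0 * v.1.1 + (sanovHom w).1 0 1 * v.1.2,
        (sanovHom w).1 1 0 * v.1.1 + (sanovHom w).1 1 1 * v.1.2) := by
  induction w using FreeGroup.induction_on generalizing v with
  | C1 => simp
  | of i =>
    simp only [sanovHom, FreeGroup.lift_apply_of, coe_sanovMatrix]
    fin_cases i <;> simp [sanovShear]
  | inv_of i _ =>
    simp only [sanovHom, map_inv, FreeGroup.lift_apply_of, coe_sanovMatrix_inv]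
    fin_cases i <;> simp [sanovShear, Equiv.Perm.inv_def] <;> ring
  | mul x y hx hy =>
    rw [map_mul, Equiv.Perm.mul_apply, hx, hy, map_mul]
    simp only [Matrix.SpecialLinearGroup.coe_mul, Matrix.mul_apply, Fin.sum_univ_two]
    exact Prod.ext (by ring) (by ring)

lemma injective_sanovHom : Function.Injective sanovHom := fun w w' h => by
  refine injective_lift_sanovShear (Equiv.ext fun v => Subtype.ext ?_)
  rw [lift_sanovShear_apply, lift_sanovShear_apply, h]

lemma abs_sanovHom_le {n : ℕ} {w : FreeGroup (Fin 2)} (hw : w ∈ wordBall freeBasis n)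
    (i j : Fin 2) : |(sanovHom w).1 i j| ≤ 3 ^ n := by
  refine wordBall_induction (p := fun n w => ∀ i j, |(sanovHom w).1 i j| ≤ 3 ^ n) ?_ ?_ ?_ hw i j
  · intro i j
    fin_cases i <;> fin_cases j <;> simp
  · intro n w h i j
    exact (h i j).trans (pow_le_pow_right₀ (by norm_num) (by omega))
  · rintro n w h _ ⟨k, rfl⟩
    have h₀ (j : Fin 2) := abs_le.1 (h 0 j)
    have h₁ (j : Fin 2) := abs_le.1 (h 1 j)
    rw [map_mul, map_mul, map_inv, sanovHom, FreeGroup.lift_apply_of, ← sanovHom]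
    refine ⟨fun i j => ?_, fun i j => ?_⟩ <;> rw [pow_succ, abs_le] <;>
      have h₀ := h₀ j <;> have h₁ := h₁ j <;>
      fin_cases k <;> fin_cases i <;>
      simp [coe_sanovMatrix, Matrix.mul_apply, Fin.sum_univ_two] <;>
      constructor <;> linarith

/-- Balls in the free group of rank two embed into finite groups of exponential order: reduce the
Sanov matrices modulo a number exceeding the differences of the entries that occur. -/
lemma exists_finite_quotient_injOn_wordBall (n : ℕ) :
    ∃ (P : Type) (_ : Group P) (_ : Finite P) (θ : FreeGroup (Fin 2) →* P),
      Set.InjOn θ (wordBall freeBasis n) ∧ Nat.card P ≤ 2 ^ (8 * n + 8) := by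
  let N : ℕ := 4 ^ (n + 1)
  have : NeZero N := ⟨by positivity⟩
  refine ⟨Matrix.SpecialLinearGroup (Fin 2) (ZMod N), inferInstance,
    Finite.of_injective _ Subtype.val_injective,
    (Matrix.SpecialLinearGroup.map (Int.castRingHom (ZMod N))).comp sanovHom, ?_, ?_⟩
  · intro w hw w' hw' h
    refine injective_sanovHom (Subtype.ext (Matrix.ext fun i j => ?_))
    have hij : (((sanovHom w).1 i j : ℤ) : ZMod N) = (((sanovHom w').1 i j : ℤ) : ZMod N) :=
      congrFun (congrFun (congrArg Subtype.val h) i) j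
    rw [ZMod.intCast_eq_intCast_iff_dvd_sub] at hij
    have h₁ := abs_le.1 (abs_sanovHom_le hw i j)
    have h₂ := abs_le.1 (abs_sanovHom_le hw' i j)
    have h₃ : (3 : ℤ) ^ n ≤ 4 ^ n := pow_le_pow_left₀ (by norm_num) (by norm_num) n
    have h₄ : (0 : ℤ) < 4 ^ n := by positivity
    have h₅ := Int.eq_zero_of_abs_lt_dvd hij (by
      rw [abs_lt]
      push_cast [N, pow_succ]
      constructor <;> linarith)
    linarith
  · refine (Nat.card_le_card_of_injective _ Subtype.val_injective).trans (le_of_eq ?_)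
    rw [Nat.card_congr Matrix.of.symm, Nat.card_fun, Nat.card_fun, Nat.card_zmod, Nat.card_fin]
    rw [show 8 * n + 8 = 2 * ((n + 1) * 2 * 2) by ring, pow_mul 2, ← pow_mul, ← pow_mul]
    norm_num
    ring

end Sanov

/-! ### A Schreier graph with prescribed level sizes -/

section Construction

variable (d : ℕ → ℕ)

/-- The vertices of a graph with a distinguished point and `d n` vertices at each level `n`. -/
abbrev LevelSet : Type := {p : ℕ × ℕ // p.2 < d p.1}

/-- The involution that, for each level `n` satisfying `ε`, interchanges vertex `j` of level `n` with
vertex `c n + j` of level `n + 1` whenever both exist. -/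
def levelFlipFun (ε : ℕ → Prop) [DecidablePred ε] (c : ℕ → ℕ) (p : ℕ × ℕ) : ℕ × ℕ :=
  if ε p.1 then (if c p.1 + p.2 < d (p.1 + 1) then (p.1 + 1, c p.1 + p.2) else p)
  else if 1 ≤ p.1 ∧ c (p.1 - 1) ≤ p.2 ∧ p.2 - c (p.1 - 1) < d (p.1 - 1) then
    (p.1 - 1, p.2 - c (p.1 - 1)) else p

variable {d} {ε : ℕ → Prop} [DecidablePred ε] {c : ℕ → ℕ}

lemma levelFlipFun_mem {p : ℕ × ℕ} (hp : p.2 < d p.1) :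
    (levelFlipFun d ε c p).2 < d (levelFlipFun d ε c p).1 := by
  unfold levelFlipFun
  split_ifs <;> simp_all

lemma levelFlipFun_levelFlipFun (hε : ∀ n, ε (n + 1) ↔ ¬ε n) {p : ℕ × ℕ} (hp : p.2 < d p.1) :
    levelFlipFun d ε c (levelFlipFun d ε c p) = p := by
  obtain ⟨n, j⟩ := p
  by_cases h : ε n
  · by_cases h' : c n + j < d (n + 1)
    · have h₁ : levelFlipFun d ε c (n, j) = (n + 1, c n + j) := by simp [levelFlipFun, h, h']
      rw [h₁]
      simp [levelFlipFun, hε, h]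
      exact hp
    · have h₁ : levelFlipFun d ε c (n, j) = (n, j) := by simp [levelFlipFun, h, h']
      rw [h₁, h₁]
  · by_cases h' : 1 ≤ n ∧ c (n - 1) ≤ j ∧ j - c (n - 1) < d (n - 1)
    · obtain ⟨m, rfl⟩ := Nat.exists_eq_add_of_le' h'.1
      rw [hε, not_not] at h
      simp only [Nat.add_sub_cancel] at h'
      have h₁ : levelFlipFun d ε c (m + 1, j) = (m, j - c m) := by
        simp [levelFlipFun, hε, h, h']
      rw [h₁]
      have h₂ : c m + (j - c m) = j := by omega
      simp only at hp
      simp [levelFlipFun, h, h₂, hp]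
    · have h₁ : levelFlipFun d ε c (n, j) = (n, j) := by
        simp only [levelFlipFun, h, if_false]; rw [if_neg h']
      rw [h₁, h₁]

/-- `levelFlipFun` as a permutation of the vertices. -/
def levelFlip (hε : ∀ n, ε (n + 1) ↔ ¬ε n) (c : ℕ → ℕ) : Equiv.Perm (LevelSet d) :=
  Function.Involutive.toPerm (fun p => ⟨levelFlipFun d ε c p.1, levelFlipFun_mem p.2⟩)
    fun p => Subtype.ext (levelFlipFun_levelFlipFun hε p.2)

lemma levelFlip_involutive (hε : ∀ n, ε (n + 1) ↔ ¬ε n) (p : LevelSet d) :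
    levelFlip hε c (levelFlip hε c p) = p :=
  Subtype.ext (levelFlipFun_levelFlipFun hε p.2)

/-- The lower level of the pair of consecutive levels `n`, `n + 1` with `ε n` that contains a given
level. -/
def lowerLevel (ε : ℕ → Prop) [DecidablePred ε] (n : ℕ) : ℕ := if ε n then n else n - 1

lemma lowerLevel_levelFlip (hε : ∀ n, ε (n + 1) ↔ ¬ε n) (p : LevelSet d) :
    lowerLevel ε (levelFlip hε c p).1.1 = lowerLevel ε p.1.1 := by
  obtain ⟨⟨n, j⟩, hp⟩ := p
  change lowerLevel ε (levelFlipFun d ε c (n, j)).1 = lowerLevel ε n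
  by_cases h : ε n
  · by_cases h' : c n + j < d (n + 1) <;> simp [levelFlipFun, lowerLevel, h, h', hε]
  · rw [levelFlipFun, if_neg h]
    split_ifs with h'
    · obtain ⟨m, rfl⟩ := Nat.exists_eq_add_of_le' h'.1
      have h'' := h
      rw [hε, not_not] at h''
      simp [lowerLevel, h, h'']
    · rfl

lemma lowerLevel_le (n : ℕ) : lowerLevel ε n ≤ n := by
  unfold lowerLevel; split_ifs <;> omega

lemma le_lowerLevel_add_one (n : ℕ) : n ≤ lowerLevel ε n + 1 := by
  unfold lowerLevel; split_ifs <;> omega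

lemma levelFlip_apply_of_lt (hε : ∀ n, ε (n + 1) ↔ ¬ε n) {n j : ℕ} (h : ε n) (hj : j < d n)
    (hc : c n + j < d (n + 1)) :
    levelFlip hε c (⟨(n, j), hj⟩ : LevelSet d) = ⟨(n + 1, c n + j), hc⟩ :=
  Subtype.ext (by
    change levelFlipFun d ε c (n, j) = _
    simp [levelFlipFun, h, hc])

/-- The permutation given by a generator of the free group: a product of two flips, whose cycles have
length at most `3`. A vertex `x` of a level `n` satisfying `ε` is sent by this permutation and by its
inverse to the (at most) two vertices of level `n + 1` that lie above it. -/
def levelPerm (d : ℕ → ℕ) (hε : ∀ n, ε (n + 1) ↔ ¬ε n) : Equiv.Perm (LevelSet d) :=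
  levelFlip hε 0 * levelFlip hε d

lemma lowerLevel_levelPerm (hε : ∀ n, ε (n + 1) ↔ ¬ε n) (p : LevelSet d) :
    lowerLevel ε (levelPerm d hε p).1.1 = lowerLevel ε p.1.1 := by
  rw [levelPerm, Equiv.Perm.mul_apply, lowerLevel_levelFlip, lowerLevel_levelFlip]

lemma levelPerm_apply_inv (hε : ∀ n, ε (n + 1) ↔ ¬ε n) (p : LevelSet d) :
    levelPerm d hε ((levelPerm d hε)⁻¹ p) = p :=
  Equiv.apply_symm_apply _ p

lemma exists_levelPerm_eq (hε : ∀ n, ε (n + 1) ↔ ¬ε n) {n : ℕ} (h : ε n)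
    (hd : d (n + 1) ≤ 2 * d n) (y : LevelSet d) (hy : y.1.1 = n + 1) :
    ∃ x : LevelSet d, x.1.1 = n ∧ (y = levelPerm d hε x ∨ y = (levelPerm d hε)⁻¹ x) := by
  obtain ⟨⟨m, j⟩, hj⟩ := y
  obtain rfl : m = n + 1 := hy
  simp only at hj
  rcases Nat.lt_or_ge j (d n) with hjn | hjn
  · refine ⟨⟨(n, j), hjn⟩, rfl, Or.inr ?_⟩
    rw [Equiv.Perm.eq_inv_iff_eq, levelPerm, Equiv.Perm.mul_apply]
    have h₁ : levelFlip hε d (⟨(n + 1, j), hj⟩ : LevelSet d) = ⟨(n + 1, j), hj⟩ :=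
      Subtype.ext (by
        change levelFlipFun d ε d (n + 1, j) = _
        simp [levelFlipFun, hε, h, hjn])
    have h₂ := levelFlip_apply_of_lt (c := 0) hε h hjn (by simpa using hj)
    rw [h₁, ← levelFlip_involutive (c := 0) hε ⟨(n, j), hjn⟩, h₂]
    simp
  · refine ⟨⟨(n, j - d n), by simp only; omega⟩, rfl, Or.inl ?_⟩
    have hj' : d n + (j - d n) = j := by omega
    rw [levelPerm, Equiv.Perm.mul_apply, levelFlip_apply_of_lt hε h _ (by rwa [hj'])]
    refine Subtype.ext ?_
    change _ = levelFlipFun d ε 0 (n + 1, d n + (j - d n))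
    simp [levelFlipFun, hε, h, hj', hjn]

/-- `levelPerm`, cut off so as to move vertices of level at most `R` only. -/
def truncatedLevelPerm (d : ℕ → ℕ) (hε : ∀ n, ε (n + 1) ↔ ¬ε n) (R : ℕ) :
    Equiv.Perm (LevelSet d) :=
  Equiv.Perm.ofSubtype (p := fun p : LevelSet d => lowerLevel ε p.1.1 < R)
    ((levelPerm d hε).subtypePerm fun p => by rw [lowerLevel_levelPerm])

lemma truncatedLevelPerm_apply_of_lt (hε : ∀ n, ε (n + 1) ↔ ¬ε n) {R : ℕ} {p : LevelSet d}
    (hp : p.1.1 < R) : truncatedLevelPerm d hε R p = levelPerm d hε p :=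
  Equiv.Perm.ofSubtype_apply_of_mem (p := fun p : LevelSet d => lowerLevel ε p.1.1 < R) (a := p) _
    ((lowerLevel_le _).trans_lt hp)

lemma truncatedLevelPerm_inv_apply_of_lt (hε : ∀ n, ε (n + 1) ↔ ¬ε n) {R : ℕ} {p : LevelSet d}
    (hp : p.1.1 < R) : (truncatedLevelPerm d hε R)⁻¹ p = (levelPerm d hε)⁻¹ p := by
  have hp' : lowerLevel ε ((levelPerm d hε)⁻¹ p).1.1 < R := by
    rw [← lowerLevel_levelPerm hε, levelPerm_apply_inv]
    exact (lowerLevel_le _).trans_lt hp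
  rw [Equiv.Perm.inv_eq_iff_eq, truncatedLevelPerm, Equiv.Perm.ofSubtype_apply_of_mem
    (p := fun p : LevelSet d => lowerLevel ε p.1.1 < R) (a := (levelPerm d hε)⁻¹ p) _ hp']
  exact (levelPerm_apply_inv hε p).symm

lemma truncatedLevelPerm_apply_of_gt (hε : ∀ n, ε (n + 1) ↔ ¬ε n) {R : ℕ} {p : LevelSet d}
    (hp : R < p.1.1) : truncatedLevelPerm d hε R p = p :=
  Equiv.Perm.ofSubtype_apply_of_not_mem _ (by
    have := le_lowerLevel_add_one (ε := ε) p.1.1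
    omega)

lemma even_succ_iff (n : ℕ) : Even (n + 1) ↔ ¬Even n := Nat.even_add_one

lemma odd_succ_iff (n : ℕ) : Odd (n + 1) ↔ ¬Odd n := Nat.odd_add_one

/-- The permutations of the vertices given by the two free generators: the first one links the levels
`2i` and `2i + 1`, the second one the levels `2i + 1` and `2i + 2`. -/
def generatorPerm (d : ℕ → ℕ) (i : Fin 2) : Equiv.Perm (LevelSet d) :=
  if i = 0 then levelPerm d even_succ_iff else levelPerm d odd_succ_iff

/-- `generatorPerm`, cut off so as to move vertices of level at most `R` only. -/
def truncatedGeneratorPerm (d : ℕ → ℕ) (R : ℕ) (i : Fin 2) : Equiv.Perm (LevelSet d) :=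
  if i = 0 then truncatedLevelPerm d even_succ_iff R else truncatedLevelPerm d odd_succ_iff R

/-- The action of the free group of rank two on the vertices. -/
instance levelAction (d : ℕ → ℕ) : MulAction (FreeGroup (Fin 2)) (LevelSet d) :=
  MulAction.compHom _ (FreeGroup.lift (generatorPerm d))

lemma of_smul (i : Fin 2) (p : LevelSet d) : FreeGroup.of i • p = generatorPerm d i p := by
  change FreeGroup.lift (generatorPerm d) (FreeGroup.of i) p = _
  rw [FreeGroup.lift_apply_of]

lemma of_inv_smul (i : Fin 2) (p : LevelSet d) :
    (FreeGroup.of i)⁻¹ • p = (generatorPerm d i)⁻¹ p := by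
  change FreeGroup.lift (generatorPerm d) (FreeGroup.of i)⁻¹ p = _
  rw [map_inv, FreeGroup.lift_apply_of]

lemma levelPerm_level_le (hε : ∀ n, ε (n + 1) ↔ ¬ε n) (p : LevelSet d) :
    (levelPerm d hε p).1.1 ≤ p.1.1 + 1 := by
  have h₁ := le_lowerLevel_add_one (ε := ε) (levelPerm d hε p).1.1
  have h₂ := lowerLevel_le (ε := ε) p.1.1
  rw [lowerLevel_levelPerm] at h₁
  omega

lemma levelPerm_inv_level_le (hε : ∀ n, ε (n + 1) ↔ ¬ε n) (p : LevelSet d) :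
    ((levelPerm d hε)⁻¹ p).1.1 ≤ p.1.1 + 1 := by
  have h₁ := le_lowerLevel_add_one (ε := ε) ((levelPerm d hε)⁻¹ p).1.1
  have h₂ := lowerLevel_le (ε := ε) p.1.1
  rw [← lowerLevel_levelPerm hε, levelPerm_apply_inv] at h₁
  omega

lemma closure_freeBasis : Subgroup.closure freeBasis = ⊤ := FreeGroup.closure_range_of _

/-- Balls around the root consist of the levels up to the radius. -/
lemma schreierBall_levelSet (h0 : d 0 = 1) (hd : ∀ n, d (n + 1) ≤ 2 * d n) (n : ℕ) :
    schreierBall freeBasis (⟨(0, 0), by simp [h0]⟩ : LevelSet d) n = {p | p.1.1 ≤ n} := by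
  induction n with
  | zero =>
    ext ⟨⟨n, j⟩, hj⟩
    simp only [schreierBall, Set.mem_singleton_iff, Subtype.mk.injEq, Prod.mk.injEq,
      Set.mem_ofPred_eq, Nat.le_zero]
    refine ⟨fun h => h.1, fun h => ⟨h, ?_⟩⟩
    subst h
    simp only at hj
    omega
  | succ n ih =>
    ext y
    rw [schreierBall, ih]
    constructor
    · rintro (hy | ⟨x, hx, _, ⟨i, rfl⟩, rfl | rfl⟩)
      · exact Nat.le_succ_of_le hy
      · rw [Set.mem_ofPred_eq] at hx ⊢
        rw [of_smul, generatorPerm]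
        split_ifs
        · exact (levelPerm_level_le _ x).trans (by omega)
        · exact (levelPerm_level_le _ x).trans (by omega)
      · rw [Set.mem_ofPred_eq] at hx ⊢
        rw [of_inv_smul, generatorPerm]
        split_ifs
        · exact (levelPerm_inv_level_le _ x).trans (by omega)
        · exact (levelPerm_inv_level_le _ x).trans (by omega)
    · intro hy
      rcases Nat.lt_or_ge n y.1.1 with h | h
      · have hy' : y.1.1 = n + 1 := le_antisymm hy h
        right
        rcases Nat.even_or_odd n with hn | hn
        · obtain ⟨x, hx, h⟩ := exists_levelPerm_eq even_succ_iff hn (hd n) y hy'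
          refine ⟨x, hx.le, FreeGroup.of 0, ⟨0, rfl⟩, ?_⟩
          rwa [of_smul, of_inv_smul, generatorPerm, if_pos rfl]
        · obtain ⟨x, hx, h⟩ := exists_levelPerm_eq odd_succ_iff hn (hd n) y hy'
          refine ⟨x, hx.le, FreeGroup.of 1, ⟨1, rfl⟩, ?_⟩
          rwa [of_smul, of_inv_smul, generatorPerm, if_neg one_ne_zero]
      · exact Or.inl h

lemma exists_smul_eq_of_mem_schreierBall {Γ Ω : Type*} [Group Γ] [MulAction Γ Ω] {S : Set Γ}
    {ω x : Ω} {n : ℕ} (hx : x ∈ schreierBall S ω n) : ∃ g : Γ, g • ω = x := by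
  induction n generalizing x with
  | zero => exact ⟨1, by rw [one_smul]; exact hx.symm⟩
  | succ n ih =>
    rcases hx with hx | ⟨y, hy, s, -, rfl | rfl⟩
    · exact ih hx
    · obtain ⟨g, rfl⟩ := ih hy
      exact ⟨s * g, mul_smul _ _ _⟩
    · obtain ⟨g, rfl⟩ := ih hy
      exact ⟨s⁻¹ * g, mul_smul _ _ _⟩

lemma isPretransitive_levelSet (h0 : d 0 = 1) (hd : ∀ n, d (n + 1) ≤ 2 * d n) :
    MulAction.IsPretransitive (FreeGroup (Fin 2)) (LevelSet d) := by
  refine MulAction.isPretransitive_iff_base (⟨(0, 0), by simp [h0]⟩ : LevelSet d) |>.2 fun x => ?_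
  refine exists_smul_eq_of_mem_schreierBall (S := freeBasis) (n := x.1.1) ?_
  rw [schreierBall_levelSet h0 hd]
  exact le_refl x.1.1

lemma encard_levelSet_le (n : ℕ) :
    {p : LevelSet d | p.1.1 ≤ n}.encard = (∑ i ∈ Finset.range (n + 1), d i : ℕ) := by
  let e : {p : LevelSet d | p.1.1 ≤ n} ≃ (i : Fin (n + 1)) × Fin (d i) :=
    { toFun := fun p => ⟨⟨p.1.1.1, Nat.lt_succ_of_le p.2⟩, ⟨p.1.1.2, p.1.2⟩⟩
      invFun := fun q => ⟨⟨(q.1, q.2), q.2.2⟩, Nat.le_of_lt_succ q.1.2⟩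
      left_inv := fun _ => rfl
      right_inv := fun _ => rfl }
  rw [Set.encard, ENat.card_congr e, ENat.card_eq_coe_fintype_card, Fintype.card_sigma]
  simp [Finset.sum_range]

/-- The growth of the Schreier graph is given by the partial sums of the sizes of the levels. -/
lemma schreierGrowth_levelSet (h0 : d 0 = 1) (hd : ∀ n, d (n + 1) ≤ 2 * d n) (n : ℕ) :
    schreierGrowth freeBasis (⟨(0, 0), by simp [h0]⟩ : LevelSet d) n =
      (∑ i ∈ Finset.range (n + 1), d i : ℕ) := by
  rw [schreierGrowth, schreierBall_levelSet h0 hd, encard_levelSet_le]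

/-- The action can be replaced by one that moves only the vertices of level at most `R`, without
changing the effect of the generators on lower levels. -/
lemma exists_truncatedAction (d : ℕ → ℕ) (R : ℕ) :
    ∃ ρ : FreeGroup (Fin 2) →* Equiv.Perm (LevelSet d),
      (∀ g, ∀ p : LevelSet d, R < p.1.1 → ρ g p = p) ∧
      ∀ s ∈ freeBasis, ∀ p : LevelSet d, p.1.1 < R → ρ s p = s • p ∧ ρ s⁻¹ p = s⁻¹ • p := by
  refine ⟨FreeGroup.lift (truncatedGeneratorPerm d R), fun g p hp => ?_, ?_⟩
  · have hi (i : Fin 2) : truncatedGeneratorPerm d R i p = p := by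
      unfold truncatedGeneratorPerm
      split_ifs <;> exact truncatedLevelPerm_apply_of_gt _ hp
    induction g using FreeGroup.induction_on with
    | C1 => simp
    | of i => rw [FreeGroup.lift_apply_of, hi]
    | inv_of i _ => rw [map_inv, FreeGroup.lift_apply_of, Equiv.Perm.inv_eq_iff_eq, hi]
    | mul x y hx hy => rw [map_mul, Equiv.Perm.mul_apply, hy, hx]
  · rintro _ ⟨i, rfl⟩ p hp
    rw [map_inv, FreeGroup.lift_apply_of, of_smul, of_inv_smul, truncatedGeneratorPerm,
      generatorPerm]
    split_ifs
    · exact ⟨truncatedLevelPerm_apply_of_lt _ hp, truncatedLevelPerm_inv_apply_of_lt _ hp⟩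
    · exact ⟨truncatedLevelPerm_apply_of_lt _ hp, truncatedLevelPerm_inv_apply_of_lt _ hp⟩

end Construction

/-! ### Comparison of growth functions, and the level sizes -/

section Growth

lemma dominated_of_le {u v : ℕ → ℕ∞} (hv : Monotone v) {C : ℕ} (hC : 0 < C)
    (h : ∀ n, u n ≤ v (C * n)) : Dominated (stepExtension u) (stepExtension v) := by
  refine ⟨C, by exact_mod_cast hC, fun x hx => (h _).trans (hv (Nat.le_floor ?_))⟩
  push_cast
  exact mul_le_mul_of_nonneg_left (Nat.floor_le hx.le) (Nat.cast_nonneg C)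

lemma lefGrowth_mono {Γ : Type*} [Group Γ] (S : Set Γ) : Monotone (lefGrowth S) := by
  intro m n hmn
  refine sInf_le_sInf ?_
  rintro k ⟨Q, i₁, i₂, π, hπ, rfl⟩
  exact ⟨Q, i₁, i₂, π, hπ.mono (wordBall_mono hmn), rfl⟩

lemma lefGrowth_le {Γ : Type*} [Group Γ] {S : Set Γ} {n : ℕ} {Q : Type} [Group Q] [Finite Q]
    {π : Γ → Q} (hπ : IsLocalEmbedding (wordBall S n) π) : lefGrowth S n ≤ Nat.card Q :=
  sInf_le ⟨Q, _, ‹_›, π, hπ, rfl⟩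

lemma lefGrowth_zero_le {Γ : Type*} [Group Γ] (S : Set Γ) : lefGrowth S 0 ≤ 1 := by
  have hπ : IsLocalEmbedding (wordBall S 0) (fun _ => (1 : Multiplicative (Fin 1))) :=
    ⟨Set.subsingleton_singleton.injOn _, fun _ _ _ _ _ => rfl⟩
  simpa using lefGrowth_le hπ

variable {f : ℕ → ℕ}

/-- The sizes of the levels of the graph attached to `f`: the successive differences of `f`, preceded
by powers of `2` up to level `k`. -/
def levelSize (f : ℕ → ℕ) (k n : ℕ) : ℕ :=
  if n ≤ k then 2 ^ n else f (n - k) - f (n - k - 1)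

lemma levelSize_zero (k : ℕ) : levelSize f k 0 = 1 := by
  simp [levelSize]

lemma levelSize_succ_le (hf : Permissible f) {k : ℕ} (hk : f 1 ≤ 2 ^ (k + 1) + 1) (n : ℕ) :
    levelSize f k (n + 1) ≤ 2 * levelSize f k n := by
  obtain ⟨hmono, h0, hf⟩ := hf
  rcases lt_trichotomy n k with h | rfl | h
  · rw [levelSize, levelSize, if_pos (by omega), if_pos (by omega), pow_succ, mul_comm]
  · rw [levelSize, levelSize, if_neg (by omega), if_pos le_rfl, Nat.add_sub_cancel_left,
      Nat.sub_self, h0]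
    rw [pow_succ] at hk
    omega
  · obtain ⟨m, rfl⟩ := Nat.exists_eq_add_of_lt h
    have h₁ := (hf (m + 1) (by omega)).2
    rw [levelSize, levelSize, if_neg (by omega), if_neg (by omega),
      show k + m + 1 + 1 - k = m + 2 by omega, show k + m + 1 - k = m + 1 by omega]
    simp only [Nat.add_sub_cancel, show m + 2 - 1 = m + 1 by omega] at h₁ ⊢
    have h₂ := hmono (Nat.lt_succ_self m)
    have h₃ := hmono (Nat.lt_succ_self (m + 1))
    have h₄ : f (m + 2) + 2 * f m ≤ 3 * f (m + 1) := by
      have : (f (m + 2) : ℝ) + 2 * f m ≤ 3 * f (m + 1) := by linarith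
      exact_mod_cast this
    simp only [Nat.succ_eq_add_one] at h₂ h₃
    omega

lemma sum_levelSize (hf : Permissible f) (k n : ℕ) :
    ∑ i ∈ Finset.range (n + k + 1), levelSize f k i = f n + (2 ^ (k + 1) - 2) := by
  induction n with
  | zero =>
    have h : ∑ i ∈ Finset.range (k + 1), levelSize f k i = ∑ i ∈ Finset.range (k + 1), 2 ^ i :=
      Finset.sum_congr rfl fun i hi => if_pos (Nat.lt_succ_iff.1 (Finset.mem_range.1 hi))
    have h' : 2 ≤ 2 ^ (k + 1) := by
      rw [pow_succ]; have := Nat.one_le_two_pow (n := k); omega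
    rw [Nat.zero_add, h, Nat.geomSum_eq le_rfl, hf.2.1]
    omega
  | succ n ih =>
    have h := hf.1 (Nat.lt_succ_self n)
    rw [show n + 1 + k + 1 = n + k + 1 + 1 by ring, Finset.sum_range_succ, ih, levelSize,
      if_neg (by omega), show n + k + 1 - k = n + 1 by omega, Nat.add_sub_cancel]
    simp only [Nat.succ_eq_add_one] at h
    omega

end Growth

/-! ### The upper bound on the LEF growth -/

section UpperBoundLevelSet

variable {d : ℕ → ℕ}

/-- Balls in the symmetric enrichment embed locally into the product of a symmetric group on a ball of
the Schreier graph with a finite group of exponential order. -/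
lemma exists_isLocalEmbedding_wordBall (h0 : d 0 = 1) (hd : ∀ n, d (n + 1) ≤ 2 * d n)
    {S : Set (SymmetricEnrichment (FreeGroup (Fin 2)) (LevelSet d))} (hS : S.Finite) :
    ∃ K : ℕ, ∀ n, ∃ (Q : Type) (_ : Group Q) (_ : Finite Q)
      (π : SymmetricEnrichment (FreeGroup (Fin 2)) (LevelSet d) → Q),
      IsLocalEmbedding (wordBall S n) π ∧
        Nat.card Q ≤ (∑ i ∈ Finset.range (2 * (K * n) + 1 + 1), d i)! * 2 ^ (8 * (K * n) + 8) := by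
  have := isPretransitive_levelSet h0 hd
  obtain ⟨K, hK⟩ := exists_wordBall_subset closure_freeBasis
    (⟨(0, 0), by simp [h0]⟩ : LevelSet d) hS
  refine ⟨K, fun n => ?_⟩
  let r := K * n
  let X : Set (LevelSet d) := {p | p.1.1 ≤ 2 * r + 1}
  have hX : X.encard = (∑ i ∈ Finset.range (2 * r + 1 + 1), d i : ℕ) := encard_levelSet_le _
  have : Finite X := Set.finite_of_encard_eq_coe hX
  have hX' : Nat.card X = ∑ i ∈ Finset.range (2 * r + 1 + 1), d i := by
    rw [Nat.card_coe_set_eq, Set.ncard_def, hX, ENat.toNat_natCast]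
  obtain ⟨P, _, _, θ, hθ, hP⟩ := exists_finite_quotient_injOn_wordBall r
  obtain ⟨ρ, hρ₁, hρ₂⟩ := exists_truncatedAction d (2 * r + 1)
  have hcard := card_fixingSubgroup_compl X
  rw [hX'] at hcard
  have : Finite (fixingSubgroup (Equiv.Perm (LevelSet d)) Xᶜ) :=
    Nat.finite_of_card_ne_zero (hcard ▸ Nat.factorial_ne_zero _)
  refine ⟨_, inferInstance, inferInstance, enrichmentMap X ρ θ,
    (isLocalEmbedding_enrichmentMap ?_ ?_ ?_ hθ).mono (hK n), ?_⟩
  · rw [schreierBall_levelSet h0 hd]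
    intro p (hp : p.1.1 ≤ r)
    change p.1.1 ≤ 2 * r + 1
    omega
  · intro g p hp
    exact hρ₁ g p (not_le.1 hp)
  · intro g hg p hp
    refine apply_eq_smul_of_mem_wordBall (R := 2 * r) (fun s hs x hx => ?_) (by omega) hg hp
    rw [schreierBall_levelSet h0 hd] at hx
    exact hρ₂ s hs x (Nat.lt_succ_of_le hx)
  · rw [Nat.card_prod, hcard]
    exact Nat.mul_le_mul_left _ hP

lemma isLEF_levelSet (h0 : d 0 = 1) (hd : ∀ n, d (n + 1) ≤ 2 * d n) :
    IsLEF (SymmetricEnrichment (FreeGroup (Fin 2)) (LevelSet d)) := by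
  intro F hF
  have := isPretransitive_levelSet h0 hd
  obtain ⟨S, hS, hSfin⟩ := Group.fg_iff.1
    (fg_symmetricEnrichment (Γ := FreeGroup (Fin 2)) (⟨(0, 0), by simp [h0]⟩ : LevelSet d))
  obtain ⟨n, hn⟩ := exists_subset_wordBall hS hF
  obtain ⟨K, hK⟩ := exists_isLocalEmbedding_wordBall h0 hd hSfin
  obtain ⟨Q, i₁, i₂, π, hπ, -⟩ := hK n
  exact ⟨Q, i₁, i₂, π, hπ.mono hn⟩

end UpperBoundLevelSet

theorem theorem1p1 (f : ℕ → ℕ) (hf : Permissible f) :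
    ∃ (Ω : Type) (_ : MulAction (FreeGroup (Fin 2)) Ω) (ω₀ : Ω),
      MulAction.IsPretransitive (FreeGroup (Fin 2)) Ω ∧
      (f 1 ≤ 3 → ∀ n : ℕ, schreierGrowth freeBasis ω₀ n = (f n : ℕ∞)) ∧
      GrowthEquiv (schreierGrowth freeBasis ω₀) (fun n => (f n : ℕ∞)) ∧
      Group.FG (SymmetricEnrichment (FreeGroup (Fin 2)) Ω) ∧
      IsLEF (SymmetricEnrichment (FreeGroup (Fin 2)) Ω) ∧
      ∀ S : Set (SymmetricEnrichment (FreeGroup (Fin 2)) Ω),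
        S.Finite → Subgroup.closure S = ⊤ →
          GrowthEquiv (lefGrowth S) (fun n => (((f n)! : ℕ) : ℕ∞)) := by
  -- With `k = 0` the level sizes are exactly the differences of `f`.
  -- Otherwise `k` is taken large enough for level `k + 1`, of size `f 1 - 1`, to be at most twice as
  -- large as level `k`.
  obtain ⟨k, hk, hk0⟩ : ∃ k, f 1 ≤ 2 ^ (k + 1) + 1 ∧ (f 1 ≤ 3 → k = 0) := by
    by_cases h : f 1 ≤ 3
    · exact ⟨0, by simpa using h, fun _ => rfl⟩
    · refine ⟨f 1, ?_, fun h' => absurd h' h⟩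
      have h₁ := Nat.lt_two_pow_self (n := f 1)
      rw [pow_succ]
      omega
  let d := levelSize f k
  have h0 : d 0 = 1 := levelSize_zero k
  have hd : ∀ n, d (n + 1) ≤ 2 * d n := levelSize_succ_le hf hk
  let g : ℕ → ℕ := fun n => ∑ i ∈ Finset.range (n + 1), d i
  have hg : Monotone g := fun m n hmn =>
    Finset.sum_le_sum_of_subset (Finset.range_subset_range.2 (by omega))
  let c := 2 ^ (k + 1) - 2
  have hgf (n : ℕ) : g (n + k) = f n + c := sum_levelSize hf k n
  have hg0 : g 0 = 1 := by simp [g, h0]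
  have hfmono := hf.1.monotone
  have hf0 : f 0 = 1 := hf.2.1
  have hgle (n : ℕ) : g n ≤ f ((c + 1) * n) := by
    rcases Nat.eq_zero_or_pos n with rfl | hn
    · rw [hg0, mul_zero, hf0]
    · calc g n ≤ g (n + k) := hg (by omega)
        _ = c + f n := by rw [hgf, add_comm]
        _ ≤ f (c + n) := hf.1.add_le_nat c n
        _ ≤ f ((c + 1) * n) := hfmono (by nlinarith)
  have hfle (n : ℕ) : f n ≤ g ((k + 1) * n) := by
    rcases Nat.eq_zero_or_pos n with rfl | hn
    · rw [mul_zero, hg0, hf0]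
    · calc f n ≤ g (n + k) := by rw [hgf]; omega
        _ ≤ g ((k + 1) * n) := hg (by nlinarith)
  let ω₀ : LevelSet d := ⟨(0, 0), by simp [h0]⟩
  have hgrowth (n : ℕ) : schreierGrowth freeBasis ω₀ n = g n := schreierGrowth_levelSet h0 hd n
  have hpre := isPretransitive_levelSet h0 hd
  refine ⟨LevelSet d, levelAction d, ω₀, hpre, ?_, ?_, fg_symmetricEnrichment ω₀,
    isLEF_levelSet h0 hd, ?_⟩
  · intro h n
    obtain rfl := hk0 h
    rw [hgrowth, ← Nat.add_zero n, hgf]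
    simp [c]
  · rw [funext hgrowth]
    exact ⟨dominated_of_le (fun m n hmn => Nat.cast_le.2 (hfmono hmn)) (Nat.succ_pos c)
        fun n => Nat.cast_le.2 (hgle n),
      dominated_of_le (fun m n hmn => Nat.cast_le.2 (hg hmn)) (Nat.succ_pos k)
        fun n => Nat.cast_le.2 (hfle n)⟩
  · intro S hSfin hS
    constructor
    · obtain ⟨K, hK⟩ := exists_isLocalEmbedding_wordBall h0 hd hSfin
      refine dominated_of_le (C := (c + 1) * (2 * K + 1) + (8 * K + 8))
        (fun m n hmn => Nat.cast_le.2 (Nat.factorial_le (hfmono hmn))) (by positivity) fun n => ?_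
      rcases Nat.eq_zero_or_pos n with rfl | hn
      · rw [mul_zero, hf0]
        simpa using lefGrowth_zero_le S
      obtain ⟨Q, _, _, π, hπ, hQ⟩ := hK n
      refine (lefGrowth_le hπ).trans (Nat.cast_le.2 (hQ.trans ?_))
      -- The exponential factor is absorbed by increasing the argument of `f` linearly.
      have hA := hgle (2 * (K * n) + 1)
      set A := (c + 1) * (2 * (K * n) + 1) with hAdef
      set M := 8 * (K * n) + 8 with hM
      have hfA : 1 ≤ f A := by rw [← hf0]; exact hfmono (Nat.zero_le _)
      calc (g (2 * (K * n) + 1))! * 2 ^ M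
          ≤ (f A)! * (f A + 1) ^ M :=
            Nat.mul_le_mul (Nat.factorial_le hA) (Nat.pow_le_pow_left (by omega) M)
        _ ≤ (f A + M)! := Nat.factorial_mul_pow_le_factorial
        _ ≤ (f (M + A))! := Nat.factorial_le (by rw [add_comm]; exact hf.1.add_le_nat M A)
        _ ≤ _ := Nat.factorial_le (hfmono (by
            rw [hAdef, hM]
            nlinarith [Nat.zero_le c, Nat.zero_le (c * (n - 1)), Nat.mul_le_mul_left c hn]))
    · obtain ⟨C, hC⟩ := exists_factorial_le_lefGrowth (Set.finite_range _) ω₀ hgrowth hS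
      refine dominated_of_le (C := C * (k + 1) + 1) (lefGrowth_mono S) (by positivity) fun n => ?_
      calc (((f n)! : ℕ) : ℕ∞) ≤ ((g ((k + 1) * n))! : ℕ) :=
            Nat.cast_le.2 (Nat.factorial_le (hfle n))
        _ ≤ lefGrowth S (C * ((k + 1) * n)) := hC _
        _ ≤ _ := lefGrowth_mono S (by nlinarith)
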